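/- **Setting.** Let $1\le K\le N$. There are $K$ agents and $N$ indivisible goods; $\mu^j_i\in\mathbb R$ is the unknown true reward of agent $j$ for good $i$. An allocation is an injective map $\phi:\{1,\dots,K\}\to\{1,\dots,N\}$; let $\mathcal M$ be the set of allocations and $$\mu_{\mathrm{maxmin}}=\max_{\phi\in\mathcal M}\ \min_{j}\ \mu^j_{\phi(j)}.$$ In round $t$ the noisy reward of agent $j$ for good $i$ is $X_{ij}(t)=\mu^j_i+\epsilon_{ij}(t)$, where each $\epsilon_{ij}(t)$ is $\sigma^2$-sub-Gaussian, i.e. $\mathbb E\,e^{s\epsilon_{ij}(t)}\le e^{\sigma^2 s^2/2}$ for all $s\in\mathbb R$ ($\sigma>0$), and the noise matrices $(\epsilon_{ij}(t))_{i,j}$, $t=1,2,\dots$, are independent across rounds. In each round the platform chooses an allocation $\phi_t$ and observes the reward of a single pair $(j,\phi_t(j))$ of it (it *pulls* this pair). **Dueling ULCB algorithm** (parameter $\alpha>2$). In rounds $t=1,\dots,NK$ every agent-good pair is pulled exactly once, in a fixed order, within fixed allocations. In every round $t>NK$, let $T^j_i(t-1)$ be the number of times the pair of agent $j$ and good $i$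 was pulled in the rounds before $t$, $\hat\mu^j_i$ the average of the rewards observed at these pulls, and $$\bar\nu^j_i(t)=\hat\mu^j_i+\sqrt{\frac{2\sigma^2\log t^{\alpha}}{T^j_i(t-1)}},\qquad \underline\nu^j_i(t)=\hat\mu^j_i-\sqrt{\frac{2\sigma^2\log t^{\alpha}}{T^j_i(t-1)}}.$$ The platform chooses $\phi_t\in\arg\max_{\phi\in\mathcal M}\min_j\bar\nu^j_{\phi(j)}(t)$ and pulls $(j_t,\phi_t(j_t))$ with $j_t\in\arg\min_j\underline\nu^j_{\phi_t(j)}(t)$; ties are broken by fixed measurable rules. The expected regret over the rounds $1,\dots,T$ is $$R_T=\mathbb E\Big[\sum_{t=1}^T\Big(\mu_{\mathrm{maxmin}}-\min_j\mu^j_{\phi_t(j)}\Big)\Big].$$ **Gap assumption.** $\Delta_{\min}>0$ is such that $\mu_{\mathrm{maxmin}}-\min_j\mu^j_{\phi(j)}>\Delta_{\min}$ for every $\phi\in\mathcal M$ with $\min_j\mu^j_{\phi(j)}\ne\mu_{\mathrm{maxmin}}$, and $|\mu^{j_1}_{i_1}-\mu^{j_2}_{i_2}|\le\Delta_{\max}$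 for all agents $j_1,j_2$ and goods $i_1,i_2$. **Theorem.** Under the gap assumption, for every horizon $T$ the regret of the Dueling ULCB algorithm is integrable and $$R_T\le 3\,\Delta_{\max}\,N\,K\left[\frac{(\sqrt{2\alpha}+2)^2\sigma^2}{\Delta_{\min}^2}\log T+2\,\frac{\alpha-1}{\alpha-2}+2\right]$$ (with the convention $\log 0=0$ for the trivial horizon $T=0$). In particular $R_T=O(NK\log T)$: for $T\ge2$, $$R_T\le 3\,\Delta_{\max}\left[\frac{(\sqrt{2\alpha}+2)^2\sigma^2}{\Delta_{\min}^2}+\frac{1}{\log 2}\Big(2\,\frac{\alpha-1}{\alpha-2}+2\Big)\right]N\,K\log T .$$ -/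

import Mathlib

open MeasureTheory ProbabilityTheory

namespace FairAlloc

/-- An allocation gives each of the `K` agents exactly one of the `N` indivisible goods, and no good
is given to two agents. -/
abbrev Alloc (K N : ℕ) : Type := Fin K ↪ Fin N

/-- The lowest entry `min_j x_{j φ(j)}` that an agent receives under the allocation `φ`. -/
noncomputable def minReward {K N : ℕ} (x : Fin K → Fin N → ℝ) (φ : Alloc K N) : ℝ :=
  ⨅ j : Fin K, x j (φ j)

/-- The max-min value `max_φ min_j x_{j φ(j)}` over all allocations. -/
noncomputable def maxMin {K N : ℕ} (x : Fin K → Fin N → ℝ) : ℝ :=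
  ⨆ φ : Alloc K N, minReward x φ

/-- The free choices in the Dueling ULCB algorithm: the order in which the initial phase pulls every
agent-good pair once, and the two oracles (that is, their tie-breaking rules). -/
structure DuelingULCB (K N : ℕ) where
  /-- The allocation used in round `t` of the initial phase `1 ≤ t ≤ N * K`. -/
  initAlloc : ℕ → Alloc K N
  /-- The agent asked for feedback in round `t` of the initial phase. -/
  initAgent : ℕ → Fin K
  /-- In the initial phase every pair (agent `j`, good `i`) is pulled exactly once. -/
  init_once : ∀ (j : Fin K) (i : Fin N),
    ∃! t : ℕ, t ∈ Finset.Icc 1 (N * K) ∧ initAgent t = j ∧ initAlloc t j = i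
  /-- The first oracle: a max-min allocation of the given matrix. -/
  allocOracle : (Fin K → Fin N → ℝ) → Alloc K N
  allocOracle_spec : ∀ (x : Fin K → Fin N → ℝ) (φ : Alloc K N),
    minReward x φ ≤ minReward x (allocOracle x)
  allocOracle_measurable : ∀ φ : Alloc K N, MeasurableSet {x | allocOracle x = φ}
  /-- The second oracle: an agent whose entry is the lowest one under the given allocation. -/
  agentOracle : Alloc K N → (Fin K → Fin N → ℝ) → Fin K
  agentOracle_spec : ∀ (φ : Alloc K N) (x : Fin K → Fin N → ℝ) (j : Fin K),
    x (agentOracle φ x) (φ (agentOracle φ x)) ≤ x j (φ j)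
  agentOracle_measurable : ∀ (φ : Alloc K N) (j : Fin K),
    MeasurableSet {x | agentOracle φ x = j}

/-- The statistics the platform keeps: for agent `j` and good `i`, the number of times the pair was
pulled so far, and the sum of the noisy rewards observed at those pulls. -/
structure Stats (K N : ℕ) where
  count : Fin K → Fin N → ℕ
  total : Fin K → Fin N → ℝ

namespace Stats

variable {K N : ℕ}

/-- No feedback yet. -/
def empty : Stats K N where
  count := fun _ _ => 0
  total := fun _ _ => 0

/-- Record the feedback `r` of agent `j` on good `i`. -/
noncomputable def observe (s : Stats K N) (j : Fin K) (i : Fin N) (r : ℝ) : Stats K N where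
  count := fun j' i' => s.count j' i' + if j' = j ∧ i' = i then 1 else 0
  total := fun j' i' => s.total j' i' + if j' = j ∧ i' = i then r else 0

/-- Average of the observed rewards of a pair. -/
noncomputable def mean (s : Stats K N) (j : Fin K) (i : Fin N) : ℝ :=
  s.total j i / (s.count j i : ℝ)

/-- The confidence width used in round `t`, from the statistics `s` collected before round `t`. -/
noncomputable def width (s : Stats K N) (α σ : ℝ) (t : ℕ) (j : Fin K) (i : Fin N) : ℝ :=
  Real.sqrt (1 / (s.count j i : ℝ) * (2 * σ ^ 2 * Real.log ((t : ℝ) ^ α)))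

/-- Upper confidence bounds. -/
noncomputable def ucb (s : Stats K N) (α σ : ℝ) (t : ℕ) (j : Fin K) (i : Fin N) : ℝ :=
  s.mean j i + s.width α σ t j i

/-- Lower confidence bounds. -/
noncomputable def lcb (s : Stats K N) (α σ : ℝ) (t : ℕ) (j : Fin K) (i : Fin N) : ℝ :=
  s.mean j i - s.width α σ t j i

end Stats

namespace DuelingULCB

variable {K N : ℕ}

/-- The decision in round `t ≥ 1` from the statistics `s` of the earlier rounds: the allocation, and
the agent asked for feedback. After the initial phase, the allocation is max-min optimal for the
upper confidence bounds, and the agent has the lowest lower confidence bound in it. -/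
noncomputable def choose (A : DuelingULCB K N) (α σ : ℝ) (t : ℕ) (s : Stats K N) :
    Alloc K N × Fin K :=
  if t ≤ N * K then (A.initAlloc t, A.initAgent t)
  else (A.allocOracle (s.ucb α σ t),
    A.agentOracle (A.allocOracle (s.ucb α σ t)) (s.lcb α σ t))

/-- The statistics after the rounds `1, …, t`, when `X s j i` is the noisy reward of agent `j` for
good `i` in round `s`. In each round only the reward of the pulled pair is observed. -/
noncomputable def statsAfter (A : DuelingULCB K N) (α σ : ℝ) (X : ℕ → Fin K → Fin N → ℝ) :
    ℕ → Stats K N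
  | 0 => Stats.empty
  | t + 1 =>
    let s := A.statsAfter α σ X t
    let φ := (A.choose α σ (t + 1) s).1
    let j := (A.choose α σ (t + 1) s).2
    s.observe j (φ j) (X (t + 1) j (φ j))

/-- The allocation `φ_t` that the algorithm uses in round `t ≥ 1`. -/
noncomputable def allocAt (A : DuelingULCB K N) (α σ : ℝ) (X : ℕ → Fin K → Fin N → ℝ) (t : ℕ) :
    Alloc K N :=
  (A.choose α σ t (A.statsAfter α σ X (t - 1))).1

/-- The cumulative regret over the rounds `1, …, T` on the reward realization `X`, when `μ` is the
matrix of true rewards. -/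
noncomputable def cumRegret (A : DuelingULCB K N) (α σ : ℝ) (μ : Fin K → Fin N → ℝ)
    (X : ℕ → Fin K → Fin N → ℝ) (T : ℕ) : ℝ :=
  ∑ t ∈ Finset.Icc 1 T, (maxMin μ - minReward μ (A.allocAt α σ X t))

end DuelingULCB

end FairAlloc

/-! The confidence widths use `α`, but accuracy is measured at a second level `β ≤ α`: a pair
deviates if its mean errs by at least the width with `β` in place of `α`. Let `a` and `b` be the
widths at levels `α` and `β` without the factor `1/√count`.

Suppose no pair deviates and the chosen allocation is suboptimal by at least `Δ`. By optimism, all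
its upper bounds are at least the max-min value `M`. Its truly worst agent has value at most `M -
Δ`, so that pair has a large width. The pulled pair may be another one, but it has the least lower
bound and an upper bound at least `M`, so its interval is long too: `Δ ≤ (a + b)/√count`
(`gap_le_of_confidence_bounds`). Its count is thus `O(log t)`, and since every pull raises a count,
there are at most `N * K * O(log T)` such rounds (`card_pulls_le`, `count_le_of_suboptimal`).

The sampling is adaptive, so a pair's noise sum `S` after `n` pulls is controlled by the
supermartingale `exp (θ S - σ² θ² n / 2)`. Markov's inequality, with a union bound over the possible
values of the random `n`, bounds the deviation probability by `2 (t + 1) ^ (1 - β)`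
(`measure_deviates_le`), which is summable for `β > 2`. With the initial `N * K` rounds this bounds
the regret (`cumRegret_le`, `integral_cumRegret_le`). Finally `β = min α 4`: taking `β = α` would
give a leading factor `8α`, too large for the stated constant when `α` is large. -/

namespace FairAlloc

/-! ### Max-min values -/

section MinReward

variable {K N : ℕ}

lemma minReward_le (x : Fin K → Fin N → ℝ) (φ : Alloc K N) (j : Fin K) :
    minReward x φ ≤ x j (φ j) :=
  ciInf_le (Set.finite_range _).bddBelow j

lemma exists_minReward_eq (hK : 1 ≤ K) (x : Fin K → Fin N → ℝ) (φ : Alloc K N) :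
    ∃ j, x j (φ j) = minReward x φ := by
  have : Nonempty (Fin K) := ⟨⟨0, hK⟩⟩
  exact exists_eq_ciInf_of_finite

lemma minReward_mono (hK : 1 ≤ K) {x y : Fin K → Fin N → ℝ} (φ : Alloc K N)
    (h : ∀ j, x j (φ j) ≤ y j (φ j)) : minReward x φ ≤ minReward y φ := by
  obtain ⟨j, hj⟩ := exists_minReward_eq hK y φ
  exact hj ▸ (minReward_le x φ j).trans (h j)

lemma minReward_le_maxMin (x : Fin K → Fin N → ℝ) (φ : Alloc K N) :
    minReward x φ ≤ maxMin x :=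
  le_ciSup (f := fun φ => minReward x φ) (Set.finite_range _).bddAbove φ

lemma exists_minReward_eq_maxMin (hKN : K ≤ N) (x : Fin K → Fin N → ℝ) :
    ∃ φ : Alloc K N, minReward x φ = maxMin x := by
  have : Nonempty (Alloc K N) := ⟨Fin.castLEEmb hKN⟩
  exact exists_eq_ciSup_of_finite

lemma maxMin_sub_minReward_le (hK : 1 ≤ K) (hKN : K ≤ N) {μ : Fin K → Fin N → ℝ} {D : ℝ}
    (hmax : ∀ j₁ j₂ i₁ i₂, |μ j₁ i₁ - μ j₂ i₂| ≤ D) (φ : Alloc K N) :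
    maxMin μ - minReward μ φ ≤ D := by
  obtain ⟨ψ, hψ⟩ := exists_minReward_eq_maxMin hKN μ
  obtain ⟨j, hj⟩ := exists_minReward_eq hK μ φ
  have h := minReward_le μ ψ j
  have h' := (le_abs_self _).trans (hmax j j (ψ j) (φ j))
  linarith

end MinReward

/-! ### Pull counts and noise sums -/

namespace DuelingULCB

variable {K N : ℕ} (A : DuelingULCB K N) (α σ : ℝ)

/-- The allocation and the agent chosen in round `t + 1`. -/
noncomputable def nextChoice (X : ℕ → Fin K → Fin N → ℝ) (t : ℕ) : Alloc K N × Fin K :=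
  A.choose α σ (t + 1) (A.statsAfter α σ X t)

/-- The pair pulled in round `t + 1` is agent `j` with good `i`. -/
def PullsNext (X : ℕ → Fin K → Fin N → ℝ) (t : ℕ) (j : Fin K) (i : Fin N) : Prop :=
  j = (A.nextChoice α σ X t).2 ∧ i = (A.nextChoice α σ X t).1 (A.nextChoice α σ X t).2

noncomputable instance (X : ℕ → Fin K → Fin N → ℝ) (t : ℕ) (j : Fin K) (i : Fin N) :
    Decidable (A.PullsNext α σ X t j i) :=
  inferInstanceAs (Decidable (_ ∧ _))

variable (X : ℕ → Fin K → Fin N → ℝ)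

lemma count_succ (t : ℕ) (j : Fin K) (i : Fin N) :
    (A.statsAfter α σ X (t + 1)).count j i =
      (A.statsAfter α σ X t).count j i + if A.PullsNext α σ X t j i then 1 else 0 :=
  rfl

lemma total_succ (t : ℕ) (j : Fin K) (i : Fin N) :
    (A.statsAfter α σ X (t + 1)).total j i =
      (A.statsAfter α σ X t).total j i +
        if A.PullsNext α σ X t j i then X (t + 1) j i else 0 := by
  have h : (A.statsAfter α σ X (t + 1)).total j i = (A.statsAfter α σ X t).total j i +
      if A.PullsNext α σ X t j i then X (t + 1) (A.nextChoice α σ X t).2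
        ((A.nextChoice α σ X t).1 (A.nextChoice α σ X t).2) else 0 := rfl
  rw [h]
  split_ifs with hp
  · rw [← hp.1, hp.2, ← hp.1]
  · rfl

lemma count_mono (j : Fin K) (i : Fin N) :
    Monotone fun t => (A.statsAfter α σ X t).count j i :=
  monotone_nat_of_le_succ fun t => by rw [count_succ]; exact Nat.le_add_right _ _

lemma count_le (t : ℕ) (j : Fin K) (i : Fin N) : (A.statsAfter α σ X t).count j i ≤ t := by
  induction t with
  | zero => exact le_rfl
  | succ t ih => rw [count_succ]; split_ifs <;> omega

lemma one_le_count {t : ℕ} (ht : N * K ≤ t) (j : Fin K) (i : Fin N) :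
    1 ≤ (A.statsAfter α σ X t).count j i := by
  obtain ⟨s, ⟨hs, hj, hi⟩, -⟩ := A.init_once j i
  obtain ⟨hs1, hs2⟩ := Finset.mem_Icc.1 hs
  -- Rounds are numbered from 1, while `nextChoice` is indexed by the number of completed rounds.
  obtain ⟨r, rfl⟩ : ∃ r, s = r + 1 := ⟨s - 1, by omega⟩
  have hc : A.nextChoice α σ X r = (A.initAlloc (r + 1), A.initAgent (r + 1)) := by
    simp [nextChoice, choose, hs2]
  have hp : A.PullsNext α σ X r j i := by
    simp only [PullsNext, hc]
    exact ⟨hj.symm, by rw [hj, hi]⟩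
  refine le_trans ?_ (A.count_mono α σ X j i (hs2.trans ht))
  simp only [count_succ, if_pos hp]
  omega

lemma count_lt_count_of_pullsNext {s t : ℕ} (hst : s < t) {j : Fin K} {i : Fin N}
    (hp : A.PullsNext α σ X s j i) :
    (A.statsAfter α σ X s).count j i < (A.statsAfter α σ X t).count j i := by
  have h : (A.statsAfter α σ X (s + 1)).count j i ≤ (A.statsAfter α σ X t).count j i :=
    A.count_mono α σ X j i hst
  rw [count_succ, if_pos hp] at h
  omega

/-- At most `N * K * L` rounds of a set pull a pair whose number of earlier pulls is between
`1` and `L`. -/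
lemma card_pulls_le {L : ℝ} (hL : 0 ≤ L) (S : Finset ℕ)
    (hS : ∀ t ∈ S, ∃ j i, A.PullsNext α σ X t j i ∧ 1 ≤ (A.statsAfter α σ X t).count j i ∧
      ((A.statsAfter α σ X t).count j i : ℝ) ≤ L) :
    (S.card : ℝ) ≤ N * K * L := by
  have hcard : S.card ≤
      ((Finset.univ : Finset (Fin K × Fin N)) ×ˢ Finset.Icc 1 ⌊L⌋₊).card := by
    -- A round is encoded by its pulled pair and that pair's earlier count. The code is injective
    -- because each pull strictly raises the count.
    refine Finset.card_le_card_of_injOn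
      (fun t => (((A.nextChoice α σ X t).2,
        (A.nextChoice α σ X t).1 (A.nextChoice α σ X t).2),
        (A.statsAfter α σ X t).count (A.nextChoice α σ X t).2
          ((A.nextChoice α σ X t).1 (A.nextChoice α σ X t).2))) ?_ ?_
    · intro t ht
      obtain ⟨j, i, ⟨rfl, rfl⟩, h1, h2⟩ := hS t ht
      simp only [Finset.coe_product, Set.mem_prod, Finset.mem_coe, Finset.mem_univ,
        Finset.mem_Icc, true_and]
      exact ⟨h1, Nat.le_floor h2⟩
    · have key : ∀ s t : ℕ, s < t →
          (((A.nextChoice α σ X s).2,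
            (A.nextChoice α σ X s).1 (A.nextChoice α σ X s).2),
            (A.statsAfter α σ X s).count (A.nextChoice α σ X s).2
              ((A.nextChoice α σ X s).1 (A.nextChoice α σ X s).2)) ≠
          (((A.nextChoice α σ X t).2,
            (A.nextChoice α σ X t).1 (A.nextChoice α σ X t).2),
            (A.statsAfter α σ X t).count (A.nextChoice α σ X t).2
              ((A.nextChoice α σ X t).1 (A.nextChoice α σ X t).2)) := by
        intro s t hst h
        obtain ⟨h12, h3⟩ := Prod.ext_iff.1 h
        obtain ⟨h1, h2⟩ := Prod.ext_iff.1 h12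
        simp only at h1 h2 h3
        rw [← h2, ← h1] at h3
        exact (A.count_lt_count_of_pullsNext α σ X hst ⟨rfl, rfl⟩).ne h3
      intro s _ t _ h
      rcases lt_trichotomy s t with hst | hst | hst
      · exact (key s t hst h).elim
      · exact hst
      · exact (key t s hst h.symm).elim
  rw [Finset.card_product, Finset.card_univ, Fintype.card_prod, Fintype.card_fin,
    Fintype.card_fin, Nat.card_Icc, Nat.add_sub_cancel] at hcard
  calc (S.card : ℝ) ≤ ((K * N * ⌊L⌋₊ : ℕ) : ℝ) := by exact_mod_cast hcard
    _ = N * K * (⌊L⌋₊ : ℝ) := by push_cast; ring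
    _ ≤ N * K * L := by gcongr; exact Nat.floor_le hL

/-- The sum of the noise in the observations of a pair up to round `t`. -/
noncomputable def noiseSum (μ : Fin K → Fin N → ℝ) (t : ℕ) (j : Fin K) (i : Fin N) : ℝ :=
  (A.statsAfter α σ X t).total j i - (A.statsAfter α σ X t).count j i * μ j i

/-- The noise in the observations of a pair up to round `t` exceeds the confidence width with
parameter `β` for round `t + 1`. -/
def Deviates (β : ℝ) (μ : Fin K → Fin N → ℝ) (t : ℕ) (j : Fin K) (i : Fin N) : Prop :=
  1 ≤ (A.statsAfter α σ X t).count j i ∧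
    Real.sqrt (2 * β * σ ^ 2 * Real.log ((t + 1 : ℕ) : ℝ)) *
      Real.sqrt ((A.statsAfter α σ X t).count j i) ≤ |A.noiseSum α σ X μ t j i|

end DuelingULCB

/-- If a pair of true value at most `M - Δ` and another pair both have upper confidence bound at
least `M`, and the second has the smaller lower confidence bound, then the width of the second is
bounded below. -/
lemma gap_le_of_confidence_bounds {a b x₀ x M Δ v₀ e₀ m : ℝ} (ha : 0 < a) (hb : 0 ≤ b)
    (hba : b ≤ a) (hv : v₀ ≤ M - Δ) (he : e₀ ≤ b * x₀) (hu₀ : M ≤ v₀ + e₀ + a * x₀)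
    (hu : M ≤ m + a * x) (hl : m - a * x ≤ v₀ + e₀ - a * x₀) : Δ ≤ (a + b) * x := by
  -- `h0` bounds the width of the bad pair from below. `h1` compares the interval of the second
  -- pair, of length `2 * a * x`, with `M` minus the lower bound of the bad pair. Eliminating `x₀`
  -- leaves a common factor `2 * a`; accuracy of the second mean `m` is never needed.
  have h0 : Δ ≤ (a + b) * x₀ := by linarith
  have h1 : Δ + (a - b) * x₀ ≤ 2 * a * x := by linarith
  have h2 : (a - b) * Δ ≤ (a - b) * ((a + b) * x₀) :=
    mul_le_mul_of_nonneg_left h0 (by linarith)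
  have h3 : (a + b) * (Δ + (a - b) * x₀) ≤ (a + b) * (2 * a * x) :=
    mul_le_mul_of_nonneg_left h1 (by linarith)
  have h4 : 2 * a * Δ ≤ 2 * a * ((a + b) * x) := by linarith
  exact le_of_mul_le_mul_left h4 (by linarith)

/-! ### Suboptimal rounds without deviations -/

namespace DuelingULCB

variable {K N : ℕ} (A : DuelingULCB K N) {α σ : ℝ} (X : ℕ → Fin K → Fin N → ℝ)

/-- Since `log (t ^ α) = α log t`, the pair enters the width only through `1 / √count`; the other
factor is common to all pairs. -/
lemma width_eq (s : Stats K N) (hα : 0 ≤ α) {t : ℕ} (ht : 1 ≤ t) (j : Fin K) (i : Fin N) :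
    s.width α σ t j i =
      Real.sqrt (2 * α * σ ^ 2 * Real.log t) * (1 / Real.sqrt (s.count j i)) := by
  have hlog : 0 ≤ Real.log (t : ℝ) := Real.log_natCast_nonneg t
  rw [Stats.width, Real.log_rpow (by exact_mod_cast ht), mul_comm, Real.sqrt_mul (by positivity),
    Real.sqrt_div zero_le_one, Real.sqrt_one]
  congr 2
  ring

lemma abs_mean_sub_lt {β : ℝ} (μ : Fin K → Fin N → ℝ) {t : ℕ} {j : Fin K} {i : Fin N}
    (hn : 1 ≤ (A.statsAfter α σ X t).count j i) (h : ¬ A.Deviates α σ X β μ t j i) :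
    |(A.statsAfter α σ X t).mean j i - μ j i| <
      Real.sqrt (2 * β * σ ^ 2 * Real.log ((t + 1 : ℕ) : ℝ)) *
        (1 / Real.sqrt ((A.statsAfter α σ X t).count j i)) := by
  have h' := not_le.1 fun h' => h ⟨hn, h'⟩
  set n := (A.statsAfter α σ X t).count j i with hn_def
  have hpos : (0 : ℝ) < n := by exact_mod_cast hn
  have hs : 0 < Real.sqrt n := Real.sqrt_pos.2 hpos
  have hm : (A.statsAfter α σ X t).mean j i - μ j i = A.noiseSum α σ X μ t j i / n := by
    rw [Stats.mean, noiseSum, ← hn_def]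
    field_simp
  rw [hm, abs_div, abs_of_pos hpos, div_lt_iff₀ hpos]
  refine h'.trans_eq ?_
  nth_rewrite 3 [← Real.mul_self_sqrt hpos.le]
  field_simp

/-- If no pair deviates, a suboptimal allocation is only used while the pulled pair has been
pulled few times. -/
lemma count_le_of_suboptimal (hK : 1 ≤ K) (hKN : K ≤ N) {β : ℝ} (hβ : 0 < β) (hβα : β ≤ α)
    (hσ : 0 < σ) {μ : Fin K → Fin N → ℝ} {Δ : ℝ} (hΔ : 0 < Δ) {t : ℕ} (ht : N * K ≤ t)
    (hgood : ∀ j i, ¬ A.Deviates α σ X β μ t j i)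
    (hsub : minReward μ (A.allocAt α σ X (t + 1)) ≤ maxMin μ - Δ) :
    ∃ j i, A.PullsNext α σ X t j i ∧ 1 ≤ (A.statsAfter α σ X t).count j i ∧
      ((A.statsAfter α σ X t).count j i : ℝ) ≤
        (Real.sqrt (2 * α) + Real.sqrt (2 * β)) ^ 2 * σ ^ 2 / Δ ^ 2 *
          Real.log ((t + 1 : ℕ) : ℝ) := by
  have hα : 0 < α := hβ.trans_le hβα
  have hNK : 1 ≤ N * K := Nat.mul_pos (by omega) hK
  set s := A.statsAfter α σ X t with hs
  set l := Real.log ((t + 1 : ℕ) : ℝ) with hl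
  have hlpos : 0 < l := Real.log_pos (by exact_mod_cast (by omega : 1 < t + 1))
  set a := Real.sqrt (2 * α * σ ^ 2 * l) with ha
  set b := Real.sqrt (2 * β * σ ^ 2 * l) with hb
  have hapos : 0 < a := Real.sqrt_pos.2 (by positivity)
  have hbnn : 0 ≤ b := Real.sqrt_nonneg _
  have hba : b ≤ a := Real.sqrt_le_sqrt (by gcongr)
  have hw : ∀ j i, s.width α σ (t + 1) j i = a * (1 / Real.sqrt (s.count j i)) :=
    fun j i => width_eq s hα.le (by omega) j i
  have hcount : ∀ j i, 1 ≤ s.count j i := A.one_le_count α σ X ht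
  have hdev : ∀ j i, |s.mean j i - μ j i| < b * (1 / Real.sqrt (s.count j i)) :=
    fun j i => A.abs_mean_sub_lt X μ (hcount j i) (hgood j i)
  have hc : A.nextChoice α σ X t = (A.allocOracle (s.ucb α σ (t + 1)),
      A.agentOracle (A.allocOracle (s.ucb α σ (t + 1))) (s.lcb α σ (t + 1))) := by
    simp [nextChoice, choose, not_le.2 (Nat.lt_succ_of_le ht), ← hs]
  have hφ : A.allocAt α σ X (t + 1) = A.allocOracle (s.ucb α σ (t + 1)) :=
    congrArg Prod.fst hc
  set φ := A.allocOracle (s.ucb α σ (t + 1)) with hφ_def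
  set j := A.agentOracle φ (s.lcb α σ (t + 1)) with hj_def
  rw [hφ] at hsub
  -- Optimism: without deviations the upper bounds dominate `μ`, as `b ≤ a`, and the oracle
  -- maximizes over allocations.
  have hopt : maxMin μ ≤ minReward (s.ucb α σ (t + 1)) φ := by
    obtain ⟨ψ, hψ⟩ := exists_minReward_eq_maxMin hKN μ
    rw [← hψ]
    refine (minReward_mono hK ψ fun k => ?_).trans (A.allocOracle_spec _ ψ)
    rw [Stats.ucb, hw]
    have h1 := (abs_lt.1 (hdev k (ψ k))).1
    have h2 : b * (1 / Real.sqrt (s.count k (ψ k))) ≤ a * (1 / Real.sqrt (s.count k (ψ k))) := by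
      gcongr
    linarith
  -- `j₀` is the truly worst agent of `φ`; the agent `j` that is pulled may differ from it.
  obtain ⟨j₀, hj₀⟩ := exists_minReward_eq hK μ φ
  have hu : ∀ k, maxMin μ ≤ s.mean k (φ k) + a * (1 / Real.sqrt (s.count k (φ k))) := by
    intro k
    rw [← hw]
    exact hopt.trans (minReward_le _ φ k)
  have hlow := A.agentOracle_spec φ (s.lcb α σ (t + 1)) j₀
  rw [← hj_def, Stats.lcb, Stats.lcb, hw, hw] at hlow
  have hgap : Δ ≤ (a + b) * (1 / Real.sqrt (s.count j (φ j))) := by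
    refine gap_le_of_confidence_bounds (v₀ := μ j₀ (φ j₀))
      (e₀ := s.mean j₀ (φ j₀) - μ j₀ (φ j₀)) (M := maxMin μ)
      (x₀ := 1 / Real.sqrt (s.count j₀ (φ j₀))) (m := s.mean j (φ j))
      hapos hbnn hba ?_ (abs_lt.1 (hdev _ _)).2.le ?_ (hu j) ?_
    · rw [hj₀]; exact hsub
    · have := hu j₀; linarith
    · linarith
  refine ⟨j, φ j, ⟨by rw [hc], by rw [hc]⟩, hcount _ _, ?_⟩
  have hn : (0 : ℝ) < s.count j (φ j) := by exact_mod_cast hcount j (φ j)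
  have hsn : 0 < Real.sqrt (s.count j (φ j)) := Real.sqrt_pos.2 hn
  rw [mul_one_div, le_div_iff₀ hsn] at hgap
  have hsq := pow_le_pow_left₀ (by positivity) hgap 2
  rw [mul_pow, Real.sq_sqrt hn.le] at hsq
  have hab : a + b = (Real.sqrt (2 * α) + Real.sqrt (2 * β)) * (σ * Real.sqrt l) := by
    have hsplit : ∀ c : ℝ, 0 ≤ c →
        Real.sqrt (2 * c * σ ^ 2 * l) = Real.sqrt (2 * c) * (σ * Real.sqrt l) := fun c hc0 => by
      rw [Real.sqrt_mul (by positivity), Real.sqrt_mul (x := 2 * c) (by positivity),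
        Real.sqrt_sq hσ.le, mul_assoc]
    rw [ha, hb, hsplit α hα.le, hsplit β hβ.le, ← add_mul]
  rw [hab, mul_pow, mul_pow, Real.sq_sqrt hlpos.le] at hsq
  rw [div_mul_eq_mul_div, le_div_iff₀ (by positivity)]
  linarith

end DuelingULCB

end FairAlloc

namespace FairAlloc

/-- Multiplying by an independent factor of expectation at most one on an event does not increase
the expectation. -/
lemma lintegral_indicator_compl_add_indicator_mul_le {Ω : Type*} {F G mΩ : MeasurableSpace Ω}
    {P : Measure Ω} (hF : F ≤ mΩ) (hG : G ≤ mΩ) (hind : Indep F G P) {f g : Ω → ENNReal}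
    (hf : Measurable[F] f) (hg : Measurable[G] g) {E : Set Ω} (hE : MeasurableSet[F] E)
    (hg1 : ∫⁻ ω, g ω ∂P ≤ 1) :
    ∫⁻ ω, (Eᶜ.indicator f ω + E.indicator f ω * g ω) ∂P ≤ ∫⁻ ω, f ω ∂P := by
  have hf' : Measurable f := hf.mono hF le_rfl
  have hE' : MeasurableSet E := hF _ hE
  rw [lintegral_add_left (hf'.indicator hE'.compl),
    lintegral_mul_eq_lintegral_mul_lintegral_of_independent_measurableSpace hF hG hind
      (hf.indicator hE) hg]
  calc ∫⁻ ω, Eᶜ.indicator f ω ∂P + (∫⁻ ω, E.indicator f ω ∂P) * ∫⁻ ω, g ω ∂P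
      ≤ ∫⁻ ω, Eᶜ.indicator f ω ∂P + (∫⁻ ω, E.indicator f ω ∂P) * 1 := by gcongr
    _ = ∫⁻ ω, f ω ∂P := by
        rw [mul_one, lintegral_indicator hE'.compl, lintegral_indicator hE', add_comm,
          lintegral_add_compl f hE']

namespace DuelingULCB

variable {K N : ℕ} (A : DuelingULCB K N) (α σ : ℝ)

/-! ### Measurability of the trajectory -/

section Measurability

variable {Ω : Type*} [MeasurableSpace Ω]

lemma measurableSet_choose_eq (r : ℕ) {s : Ω → Stats K N}
    (hc : ∀ j i, Measurable fun ω => (s ω).count j i)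
    (ht : ∀ j i, Measurable fun ω => (s ω).total j i) (c : Alloc K N × Fin K) :
    MeasurableSet {ω | A.choose α σ r (s ω) = c} := by
  by_cases hr : r ≤ N * K
  · simp only [choose, if_pos hr]
    exact MeasurableSet.const _
  · have hcast : ∀ j i, Measurable fun ω => ((s ω).count j i : ℝ) := fun j i =>
      measurable_from_nat.comp (hc j i)
    have hw : ∀ j i, Measurable fun ω => (s ω).width α σ r j i := fun j i =>
      (((hcast j i).const_div 1).mul_const _).sqrt
    have hm : ∀ j i, Measurable fun ω => (s ω).mean j i := fun j i => (ht j i).div (hcast j i)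
    have hu : Measurable fun ω => (s ω).ucb α σ r :=
      measurable_pi_lambda _ fun j => measurable_pi_lambda _ fun i => (hm j i).add (hw j i)
    have hl : Measurable fun ω => (s ω).lcb α σ r :=
      measurable_pi_lambda _ fun j => measurable_pi_lambda _ fun i => (hm j i).sub (hw j i)
    -- The agent oracle is measurable only for a fixed allocation, so the allocation is fixed to
    -- `c.1` first.
    have heq : {ω | A.choose α σ r (s ω) = c} =
        {ω | A.allocOracle ((s ω).ucb α σ r) = c.1} ∩
          {ω | A.agentOracle c.1 ((s ω).lcb α σ r) = c.2} := by
      ext ω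
      simp only [choose, if_neg hr, Set.mem_ofPred_eq, Set.mem_inter_iff, Prod.ext_iff]
      constructor
      · rintro ⟨h1, h2⟩
        exact ⟨h1, h1 ▸ h2⟩
      · rintro ⟨h1, h2⟩
        exact ⟨h1, by rw [h1]; exact h2⟩
    rw [heq]
    exact (hu (A.allocOracle_measurable c.1)).inter (hl (A.agentOracle_measurable c.1 c.2))

/-- Measurability of the statistics is a hypothesis here so that the result can serve inside the
induction of `measurable_statsAfter`. -/
lemma measurableSet_pullsNext_of_statsAfter (Y : ℕ → Fin K → Fin N → Ω → ℝ) (t : ℕ)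
    (hc : ∀ j i, Measurable fun ω => (A.statsAfter α σ (fun t j i => Y t j i ω) t).count j i)
    (ht : ∀ j i, Measurable fun ω => (A.statsAfter α σ (fun t j i => Y t j i ω) t).total j i)
    (j : Fin K) (i : Fin N) :
    MeasurableSet {ω | A.PullsNext α σ (fun t j i => Y t j i ω) t j i} := by
  have heq : {ω | A.PullsNext α σ (fun t j i => Y t j i ω) t j i} =
      ⋃ c : {c : Alloc K N × Fin K // j = c.2 ∧ i = c.1 c.2},
        {ω | A.choose α σ (t + 1) (A.statsAfter α σ (fun t j i => Y t j i ω) t) = c} := by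
    ext ω
    simp only [Set.mem_ofPred_eq, Set.mem_iUnion]
    exact ⟨fun h => ⟨⟨_, h⟩, rfl⟩, fun ⟨c, h⟩ => by
      rw [PullsNext, nextChoice, h]; exact c.2⟩
  rw [heq]
  exact MeasurableSet.iUnion fun c => A.measurableSet_choose_eq α σ (t + 1) hc ht c

/-- Only rewards up to round `t` need be measurable, so the result also applies to the σ-algebra
generated by the noise up to round `t`. -/
lemma measurable_statsAfter (Y : ℕ → Fin K → Fin N → Ω → ℝ) (t : ℕ)
    (hY : ∀ s ≤ t, ∀ j i, Measurable (Y s j i)) :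
    (∀ j i, Measurable fun ω => (A.statsAfter α σ (fun t j i => Y t j i ω) t).count j i) ∧
      (∀ j i, Measurable fun ω => (A.statsAfter α σ (fun t j i => Y t j i ω) t).total j i) := by
  induction t with
  | zero => exact ⟨fun j i => measurable_const, fun j i => measurable_const⟩
  | succ t ih =>
    obtain ⟨hc, ht⟩ := ih fun s hs => hY s (hs.trans t.le_succ)
    have hp := A.measurableSet_pullsNext_of_statsAfter α σ Y t hc ht
    simp only [count_succ, total_succ]
    exact ⟨fun j i => (hc j i).add (Measurable.ite (hp j i) measurable_const measurable_const),
      fun j i => (ht j i).add (Measurable.ite (hp j i) (hY _ le_rfl j i) measurable_const)⟩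

lemma measurableSet_pullsNext (Y : ℕ → Fin K → Fin N → Ω → ℝ) (t : ℕ)
    (hY : ∀ s ≤ t, ∀ j i, Measurable (Y s j i)) (j : Fin K) (i : Fin N) :
    MeasurableSet {ω | A.PullsNext α σ (fun t j i => Y t j i ω) t j i} :=
  A.measurableSet_pullsNext_of_statsAfter α σ Y t (A.measurable_statsAfter α σ Y t hY).1
    (A.measurable_statsAfter α σ Y t hY).2 j i

lemma measurable_noiseSum (Y : ℕ → Fin K → Fin N → Ω → ℝ) (μ : Fin K → Fin N → ℝ) (t : ℕ)
    (hY : ∀ s ≤ t, ∀ j i, Measurable (Y s j i)) (j : Fin K) (i : Fin N) :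
    Measurable fun ω => A.noiseSum α σ (fun t j i => Y t j i ω) μ t j i := by
  obtain ⟨hc, ht⟩ := A.measurable_statsAfter α σ Y t hY
  exact (ht j i).sub ((measurable_from_nat.comp (hc j i)).mul_const _)

lemma measurableSet_deviates (Y : ℕ → Fin K → Fin N → Ω → ℝ) (β : ℝ) (μ : Fin K → Fin N → ℝ)
    (t : ℕ) (hY : ∀ s ≤ t, ∀ j i, Measurable (Y s j i)) (j : Fin K) (i : Fin N) :
    MeasurableSet {ω | A.Deviates α σ (fun t j i => Y t j i ω) β μ t j i} := by
  obtain ⟨hc, -⟩ := A.measurable_statsAfter α σ Y t hY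
  have hcast : Measurable fun ω =>
      ((A.statsAfter α σ (fun t j i => Y t j i ω) t).count j i : ℝ) :=
    measurable_from_nat.comp (hc j i)
  exact (measurableSet_le measurable_const (hc j i)).inter
    (measurableSet_le (hcast.sqrt.const_mul _)
      (A.measurable_noiseSum α σ Y μ t hY j i).abs)

lemma measurable_cumRegret (Y : ℕ → Fin K → Fin N → Ω → ℝ) (μ : Fin K → Fin N → ℝ)
    (hY : ∀ s j i, Measurable (Y s j i)) (T : ℕ) :
    Measurable fun ω => A.cumRegret α σ μ (fun t j i => Y t j i ω) T := by
  refine Finset.measurable_fun_sum _ fun t _ => measurable_const.sub ?_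
  obtain ⟨hc, ht⟩ := A.measurable_statsAfter α σ Y (t - 1) fun s _ => hY s
  let _ : MeasurableSpace (Alloc K N × Fin K) := ⊤
  have hm : Measurable fun ω =>
      A.choose α σ t (A.statsAfter α σ (fun t j i => Y t j i ω) (t - 1)) :=
    measurable_to_countable' fun c => A.measurableSet_choose_eq α σ t hc ht c
  exact (measurable_from_top (f := fun c : Alloc K N × Fin K => minReward μ c.1)).comp hm

end Measurability

lemma noiseSum_succ (ε : ℕ → Fin K → Fin N → ℝ) (μ : Fin K → Fin N → ℝ) (t : ℕ)
    (j : Fin K) (i : Fin N) :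
    A.noiseSum α σ (fun t j i => μ j i + ε t j i) μ (t + 1) j i =
      A.noiseSum α σ (fun t j i => μ j i + ε t j i) μ t j i +
        if A.PullsNext α σ (fun t j i => μ j i + ε t j i) t j i then ε (t + 1) j i else 0 := by
  rw [noiseSum, noiseSum, total_succ, count_succ]
  split_ifs <;> push_cast <;> ring

/-- The exponent of the exponential supermartingale of the noise observed from a pair. -/
noncomputable def expoSum (X : ℕ → Fin K → Fin N → ℝ) (μ : Fin K → Fin N → ℝ) (θ : ℝ) (t : ℕ)
    (j : Fin K) (i : Fin N) : ℝ :=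
  θ * A.noiseSum α σ X μ t j i - σ ^ 2 * θ ^ 2 / 2 * (A.statsAfter α σ X t).count j i

lemma expoSum_succ (ε : ℕ → Fin K → Fin N → ℝ) (μ : Fin K → Fin N → ℝ) (θ : ℝ) (t : ℕ)
    (j : Fin K) (i : Fin N) :
    A.expoSum α σ (fun t j i => μ j i + ε t j i) μ θ (t + 1) j i =
      A.expoSum α σ (fun t j i => μ j i + ε t j i) μ θ t j i +
        if A.PullsNext α σ (fun t j i => μ j i + ε t j i) t j i
        then θ * ε (t + 1) j i - σ ^ 2 * θ ^ 2 / 2 else 0 := by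
  rw [expoSum, expoSum, noiseSum_succ, count_succ]
  split_ifs <;> push_cast <;> ring

/-! ### Exponential supermartingale and deviation probability -/

section Concentration

variable {Ω : Type*} [mΩ : MeasurableSpace Ω] {P : Measure Ω}
  {ε : ℕ → Fin K → Fin N → Ω → ℝ} (μ : Fin K → Fin N → ℝ)

lemma lintegral_exp_le_one {Z : Ω → ℝ} (h : HasSubgaussianMGF Z (Real.toNNReal (σ ^ 2)) P)
    (θ : ℝ) : ∫⁻ ω, ENNReal.ofReal (Real.exp (θ * Z ω - σ ^ 2 * θ ^ 2 / 2)) ∂P ≤ 1 := by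
  have hmgf := h.mgf_le θ
  rw [Real.coe_toNNReal _ (sq_nonneg σ)] at hmgf
  have hint : Integrable (fun ω => Real.exp (θ * Z ω - σ ^ 2 * θ ^ 2 / 2)) P := by
    simp only [Real.exp_sub]
    exact (h.integrable_exp_mul θ).div_const _
  rw [← ofReal_integral_eq_lintegral_ofReal hint (ae_of_all _ fun _ => (Real.exp_pos _).le)]
  refine ENNReal.ofReal_le_one.2 ?_
  simp only [Real.exp_sub]
  rw [integral_div, div_le_one (Real.exp_pos _)]
  exact hmgf

/-- Whether round `t + 1` pulls the pair is decided by the noise up to round `t`. On that event the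
exponential gains an independent factor of mean at most one; elsewhere it is unchanged. -/
lemma lintegral_exp_expoSum_le_one [IsProbabilityMeasure P]
    (hε : ∀ t j i, Measurable (ε t j i))
    (hindep : iIndepFun (fun (t : ℕ) (ω : Ω) (j : Fin K) (i : Fin N) => ε t j i ω) P)
    (hsub : ∀ t j i, HasSubgaussianMGF (ε t j i) (Real.toNNReal (σ ^ 2)) P)
    (θ : ℝ) (t : ℕ) (j : Fin K) (i : Fin N) :
    ∫⁻ ω, ENNReal.ofReal (Real.exp
      (A.expoSum α σ (fun t j i => μ j i + ε t j i ω) μ θ t j i)) ∂P ≤ 1 := by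
  induction t with
  | zero => simp [expoSum, noiseSum, statsAfter, Stats.empty]
  | succ t ih =>
    let m : ℕ → MeasurableSpace Ω := fun s =>
      MeasurableSpace.comap (fun (ω : Ω) (j : Fin K) (i : Fin N) => ε s j i ω) inferInstance
    have hmle : ∀ s, m s ≤ mΩ := fun s => Measurable.comap_le
      (measurable_pi_lambda _ fun j => measurable_pi_lambda _ fun i => hε s j i)
    have hmeas : ∀ s j i, Measurable[m s] (ε s j i) := fun s j i =>
      (measurable_pi_apply i).comp
        ((measurable_pi_apply j).comp
          (comap_measurable fun (ω : Ω) (j : Fin K) (i : Fin N) => ε s j i ω))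
    let F : ℕ → MeasurableSpace Ω := fun t => ⨆ s ∈ Set.Iic t, m s
    have hF : F t ≤ mΩ := iSup₂_le fun s _ => hmle s
    have hind : Indep (F t) (m (t + 1)) P := by
      have h := indep_iSup_of_disjoint hmle hindep
        (S := Set.Iic t) (T := {t + 1}) (by simp)
      simpa [F] using h
    have hY : ∀ s ≤ t, ∀ j i, Measurable[F t] fun ω => μ j i + ε s j i ω := fun s hs j i =>
      ((hmeas s j i).mono (le_iSup₂_of_le s hs le_rfl) le_rfl).const_add _
    set f : Ω → ENNReal := fun ω => ENNReal.ofReal (Real.exp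
      (A.expoSum α σ (fun t j i => μ j i + ε t j i ω) μ θ t j i)) with hf
    set E : Set Ω := {ω | A.PullsNext α σ (fun t j i => μ j i + ε t j i ω) t j i} with hE
    set g : Ω → ENNReal := fun ω =>
      ENNReal.ofReal (Real.exp (θ * ε (t + 1) j i ω - σ ^ 2 * θ ^ 2 / 2)) with hg
    -- Here and in `hfm` the σ-algebra on `Ω` is the past `F t`, not the ambient one.
    have hEm : MeasurableSet[F t] E := @measurableSet_pullsNext K N A α σ Ω (F t) _ t hY j i
    have hfm : Measurable[F t] f := by
      have h1 := @measurable_noiseSum K N A α σ Ω (F t) _ μ t hY j i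
      have h2 := (@measurable_statsAfter K N A α σ Ω (F t) _ t hY).1 j i
      exact ((h1.const_mul θ).sub ((measurable_from_nat.comp h2).const_mul _)).exp.ennreal_ofReal
    have hgm : Measurable[m (t + 1)] g :=
      (((hmeas (t + 1) j i).const_mul θ).sub_const _).exp.ennreal_ofReal
    have hsplit : ∀ ω, ENNReal.ofReal (Real.exp
        (A.expoSum α σ (fun t j i => μ j i + ε t j i ω) μ θ (t + 1) j i)) =
          Eᶜ.indicator f ω + E.indicator f ω * g ω := by
      intro ω
      rw [A.expoSum_succ α σ (fun t j i => ε t j i ω)]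
      by_cases hω : ω ∈ E
      · rw [if_pos (show A.PullsNext α σ _ t j i from hω), Real.exp_add, ENNReal.ofReal_mul (Real.exp_pos _).le,
          Set.indicator_of_mem hω, Set.indicator_of_notMem (Set.notMem_compl_iff.2 hω), zero_add]
      · rw [if_neg (show ¬ A.PullsNext α σ _ t j i from hω), add_zero, Set.indicator_of_notMem hω, zero_mul, add_zero,
          Set.indicator_of_mem (show ω ∈ Eᶜ from hω)]
    simp only [hsplit]
    exact (lintegral_indicator_compl_add_indicator_mul_le hF (hmle _) hind hfm hgm hEm
      (lintegral_exp_le_one σ (hsub _ _ _) θ)).trans ih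

lemma measure_le_expoSum_le [IsProbabilityMeasure P]
    (hε : ∀ t j i, Measurable (ε t j i))
    (hindep : iIndepFun (fun (t : ℕ) (ω : Ω) (j : Fin K) (i : Fin N) => ε t j i ω) P)
    (hsub : ∀ t j i, HasSubgaussianMGF (ε t j i) (Real.toNNReal (σ ^ 2)) P)
    (θ c : ℝ) (t : ℕ) (j : Fin K) (i : Fin N) :
    P.real {ω | c ≤ A.expoSum α σ (fun t j i => μ j i + ε t j i ω) μ θ t j i} ≤
      Real.exp (-c) := by
  have hY : ∀ s ≤ t, ∀ j i, Measurable fun ω => μ j i + ε s j i ω := fun s _ j i =>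
    (hε s j i).const_add _
  have hm : Measurable fun ω => ENNReal.ofReal (Real.exp
      (A.expoSum α σ (fun t j i => μ j i + ε t j i ω) μ θ t j i)) := by
    have h1 := A.measurable_noiseSum α σ _ μ t hY j i
    have h2 := (A.measurable_statsAfter α σ _ t hY).1 j i
    exact ((h1.const_mul θ).sub ((measurable_from_nat.comp h2).const_mul _)).exp.ennreal_ofReal
  refine ENNReal.toReal_le_of_le_ofReal (Real.exp_pos _).le ?_
  have hset : {ω | c ≤ A.expoSum α σ (fun t j i => μ j i + ε t j i ω) μ θ t j i} =
      {ω | ENNReal.ofReal (Real.exp c) ≤ ENNReal.ofReal (Real.exp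
        (A.expoSum α σ (fun t j i => μ j i + ε t j i ω) μ θ t j i))} := by
    ext ω
    simp only [Set.mem_ofPred_eq]
    rw [ENNReal.ofReal_le_ofReal_iff (Real.exp_pos _).le, Real.exp_le_exp]
  rw [hset]
  refine (meas_ge_le_lintegral_div hm.aemeasurable (by simp [Real.exp_pos])
    ENNReal.ofReal_ne_top).trans ?_
  rw [Real.exp_neg, ENNReal.ofReal_inv_of_pos (Real.exp_pos _), ← one_div]
  gcongr
  exact A.lintegral_exp_expoSum_le_one α σ μ hε hindep hsub θ t j i

/-- The best `θ` depends on the count, which is random. Each possible count `n ≤ t` therefore gets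
its own fixed `θ n`, used with both signs for the two tails; the union bound costs a factor `2 * t`.
-/
lemma measure_deviates_le [IsProbabilityMeasure P] (hσ : 0 < σ)
    (hε : ∀ t j i, Measurable (ε t j i))
    (hindep : iIndepFun (fun (t : ℕ) (ω : Ω) (j : Fin K) (i : Fin N) => ε t j i ω) P)
    (hsub : ∀ t j i, HasSubgaussianMGF (ε t j i) (Real.toNNReal (σ ^ 2)) P)
    {β : ℝ} (hβ : 0 < β) (t : ℕ) (j : Fin K) (i : Fin N) :
    P.real {ω | A.Deviates α σ (fun t j i => μ j i + ε t j i ω) β μ t j i} ≤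
      2 * ((t + 1 : ℕ) : ℝ) ^ (1 - β) := by
  have hlog : 0 ≤ Real.log ((t + 1 : ℕ) : ℝ) := Real.log_natCast_nonneg _
  set c := β * Real.log ((t + 1 : ℕ) : ℝ) with hc
  set b := Real.sqrt (2 * β * σ ^ 2 * Real.log ((t + 1 : ℕ) : ℝ)) with hb
  have hb2 : b ^ 2 = 2 * σ ^ 2 * c := by
    rw [hb, Real.sq_sqrt (by positivity), hc]; ring
  -- This `θ n` maximizes `θ * b * √n - σ² * θ² * n / 2`; the maximum is `2 * c - c = c`.
  let θ : ℕ → ℝ := fun n => b / (σ ^ 2 * Real.sqrt n)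
  let U : ℝ → Set Ω := fun θ =>
    {ω | c ≤ A.expoSum α σ (fun t j i => μ j i + ε t j i ω) μ θ t j i}
  have hsubset : {ω | A.Deviates α σ (fun t j i => μ j i + ε t j i ω) β μ t j i} ⊆
      ⋃ n ∈ Finset.Icc 1 t, (U (θ n) ∪ U (-θ n)) := by
    rintro ω ⟨hn1, hdev⟩
    set n := (A.statsAfter α σ (fun t j i => μ j i + ε t j i ω) t).count j i with hn
    set S := A.noiseSum α σ (fun t j i => μ j i + ε t j i ω) μ t j i with hS
    have hnpos : (0 : ℝ) < n := by exact_mod_cast hn1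
    have hsn : 0 < Real.sqrt n := Real.sqrt_pos.2 hnpos
    have hθ : 0 ≤ θ n := by positivity
    have hquad : σ ^ 2 * θ n ^ 2 / 2 * n = c := by
      simp only [θ, div_pow, mul_pow, hb2, Real.sq_sqrt hnpos.le]
      field_simp
    have hlin : θ n * (b * Real.sqrt n) = 2 * c := by
      have h : θ n * (b * Real.sqrt n) = b ^ 2 / σ ^ 2 := by
        simp only [θ]; field_simp
      rw [h, hb2]; field_simp
    have hmul := mul_le_mul_of_nonneg_left hdev hθ
    rw [hlin] at hmul
    refine Set.mem_biUnion (x := n)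
      (Finset.mem_coe.2 (Finset.mem_Icc.2 ⟨hn1, A.count_le α σ _ t j i⟩)) ?_
    rcases abs_choice S with habs | habs
    · left
      change c ≤ θ n * S - σ ^ 2 * θ n ^ 2 / 2 * n
      rw [habs] at hmul
      linarith
    · right
      change c ≤ -θ n * S - σ ^ 2 * (-θ n) ^ 2 / 2 * n
      rw [habs] at hmul
      rw [neg_sq, hquad]
      linarith
  have hU : ∀ θ, P.real (U θ) ≤ Real.exp (-c) := fun θ =>
    A.measure_le_expoSum_le α σ μ hε hindep hsub θ c t j i
  have hpos : (0 : ℝ) < ((t + 1 : ℕ) : ℝ) := by positivity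
  have hexp : Real.exp (-c) = ((t + 1 : ℕ) : ℝ) ^ (-β) := by
    rw [Real.rpow_def_of_pos hpos, hc]; ring_nf
  calc P.real {ω | A.Deviates α σ (fun t j i => μ j i + ε t j i ω) β μ t j i}
      ≤ P.real (⋃ n ∈ Finset.Icc 1 t, (U (θ n) ∪ U (-θ n))) := measureReal_mono hsubset (measure_ne_top P _)
    _ ≤ ∑ n ∈ Finset.Icc 1 t, P.real (U (θ n) ∪ U (-θ n)) :=
        measureReal_biUnion_finset_le _ _
    _ ≤ ∑ n ∈ Finset.Icc 1 t, 2 * Real.exp (-c) := by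
        refine Finset.sum_le_sum fun n _ => (measureReal_union_le _ _).trans ?_
        linarith [hU (θ n), hU (-θ n)]
    _ = 2 * (t * Real.exp (-c)) := by
        rw [Finset.sum_const, Nat.card_Icc, Nat.add_sub_cancel, nsmul_eq_mul]; ring
    _ ≤ 2 * (((t + 1 : ℕ) : ℝ) * Real.exp (-c)) := by gcongr; omega
    _ = 2 * ((t + 1 : ℕ) : ℝ) ^ (1 - β) := by
        rw [hexp, sub_eq_add_neg, Real.rpow_add hpos, Real.rpow_one]

end Concentration

end DuelingULCB

end FairAlloc

/-! ### Summation of the tail and pathwise regret -/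

namespace FairAlloc

/-- A discrete integral comparison for `x ^ (-u - 1)`, obtained from `log x ≤ x - 1` and `1 + x ≤
exp x`. -/
lemma mul_rpow_succ_le_sub {u : ℝ} (hu : 0 < u) {T : ℕ} (hT : 1 ≤ T) :
    u * ((T + 1 : ℕ) : ℝ) ^ (-u - 1) ≤ (T : ℝ) ^ (-u) - ((T + 1 : ℕ) : ℝ) ^ (-u) := by
  have hT0 : (0 : ℝ) < T := by exact_mod_cast hT
  have hy0 : (0 : ℝ) < ((T + 1 : ℕ) : ℝ) := by positivity
  set y : ℝ := ((T + 1 : ℕ) : ℝ) with hy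
  have hTy : (T : ℝ) = y - 1 := by rw [hy]; push_cast; ring
  have hq : 0 < (T : ℝ) / y := by positivity
  have hlog : Real.log ((T : ℝ) / y) ≤ -(1 / y) := by
    refine (Real.log_le_sub_one_of_pos hq).trans_eq ?_
    rw [hTy]; field_simp; ring
  have hr : 1 + u / y ≤ ((T : ℝ) / y) ^ (-u) := by
    rw [Real.rpow_def_of_pos hq]
    have h1 := Real.add_one_le_exp (Real.log ((T : ℝ) / y) * -u)
    have h2 : u * (1 / y) ≤ u * -Real.log ((T : ℝ) / y) :=
      mul_le_mul_of_nonneg_left (by linarith) hu.le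
    rw [mul_one_div] at h2
    linarith
  have hmul : (T : ℝ) ^ (-u) = y ^ (-u) * ((T : ℝ) / y) ^ (-u) := by
    rw [← Real.mul_rpow hy0.le hq.le]; congr 1; field_simp
  have hyu : 0 < y ^ (-u) := Real.rpow_pos_of_pos hy0 _
  have h := mul_le_mul_of_nonneg_left hr hyu.le
  rw [Real.rpow_sub_one hy0.ne', hmul]
  have h' : u * (y ^ (-u) / y) = y ^ (-u) * (u / y) := by ring
  linarith

/-- With `u = β - 2`, `mul_rpow_succ_le_sub` makes the sum telescope. The condition `1 ≤ m` drops
the term `t = 0`, which equals 1. -/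
lemma sum_Ico_rpow_le {β : ℝ} (hβ : 2 < β) {m : ℕ} (hm : 1 ≤ m) (T : ℕ) :
    ∑ t ∈ Finset.Ico m T, ((t + 1 : ℕ) : ℝ) ^ (1 - β) ≤ 1 / (β - 2) := by
  have hu : 0 < β - 2 := by linarith
  have htel : ∀ T : ℕ, 1 ≤ T → (β - 2) * ∑ t ∈ Finset.Ico 1 T, ((t + 1 : ℕ) : ℝ) ^ (1 - β) ≤
      1 - (T : ℝ) ^ (-(β - 2)) := by
    intro T hT
    induction T, hT using Nat.le_induction with
    | base => simp
    | succ T hT ih =>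
      have h := mul_rpow_succ_le_sub hu hT
      rw [show -(β - 2) - 1 = 1 - β by ring] at h
      rw [Finset.sum_Ico_succ_top hT, mul_add]
      linarith
  rw [le_div_iff₀' hu]
  rcases Nat.eq_zero_or_pos T with rfl | hT
  · simp
  · calc (β - 2) * ∑ t ∈ Finset.Ico m T, ((t + 1 : ℕ) : ℝ) ^ (1 - β)
        ≤ (β - 2) * ∑ t ∈ Finset.Ico 1 T, ((t + 1 : ℕ) : ℝ) ^ (1 - β) := by
          gcongr
      _ ≤ 1 - (T : ℝ) ^ (-(β - 2)) := htel T hT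
      _ ≤ 1 := by linarith [Real.rpow_nonneg (Nat.cast_nonneg (α := ℝ) T) (-(β - 2))]

namespace DuelingULCB

variable {K N : ℕ} (A : DuelingULCB K N) {α σ : ℝ}

open Classical in
/-- The regret on a fixed reward realization: the initial phase, the rounds in which the pulled
pair has few observations, and the rounds in which some pair deviates. -/
lemma cumRegret_le (hK : 1 ≤ K) (hKN : K ≤ N) {β : ℝ} (hβ : 0 < β) (hβα : β ≤ α) (hσ : 0 < σ)
    {μ : Fin K → Fin N → ℝ} {Δ D : ℝ} (hΔ : 0 < Δ)
    (hgap : ∀ φ : Alloc K N, minReward μ φ ≠ maxMin μ → Δ < maxMin μ - minReward μ φ)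
    (hmax : ∀ j₁ j₂ i₁ i₂, |μ j₁ i₁ - μ j₂ i₂| ≤ D) (X : ℕ → Fin K → Fin N → ℝ) (T : ℕ) :
    A.cumRegret α σ μ X T ≤
      D * (N * K + N * K * ((Real.sqrt (2 * α) + Real.sqrt (2 * β)) ^ 2 * σ ^ 2 / Δ ^ 2 *
          Real.log T) +
        ∑ t ∈ Finset.Ico (N * K) T, ∑ j, ∑ i, if A.Deviates α σ X β μ t j i then 1 else 0) := by
  have hD : 0 ≤ D := by
    simpa using hmax ⟨0, hK⟩ ⟨0, hK⟩ ⟨0, hK.trans hKN⟩ ⟨0, hK.trans hKN⟩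
  set C := (Real.sqrt (2 * α) + Real.sqrt (2 * β)) ^ 2 * σ ^ 2 / Δ ^ 2 with hC
  have hC0 : 0 ≤ C := by positivity
  let reg : ℕ → ℝ := fun t => maxMin μ - minReward μ (A.allocAt α σ X (t + 1))
  have hreg : ∀ t, reg t ≤ D := fun t => maxMin_sub_minReward_le hK hKN hmax _
  let dev : ℕ → ℝ := fun t => ∑ j, ∑ i, if A.Deviates α σ X β μ t j i then 1 else 0
  let S : Finset ℕ := (Finset.Ico (N * K) T).filter fun t =>
    (∀ j i, ¬ A.Deviates α σ X β μ t j i) ∧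
      minReward μ (A.allocAt α σ X (t + 1)) ≠ maxMin μ
  have hsum : A.cumRegret α σ μ X T = ∑ t ∈ Finset.range T, reg t := by
    rw [cumRegret, ← Finset.Ico_add_one_right_eq_Icc, Finset.sum_Ico_eq_sum_range]
    exact Finset.sum_congr rfl fun t _ => by rw [add_comm 1 t]
  have hS : (S.card : ℝ) ≤ N * K * (C * Real.log T) := by
    refine A.card_pulls_le α σ X (mul_nonneg hC0 (Real.log_natCast_nonneg T)) S fun t ht => ?_
    obtain ⟨ht, hgood, hne⟩ := Finset.mem_filter.1 ht
    obtain ⟨ht1, ht2⟩ := Finset.mem_Ico.1 ht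
    obtain ⟨j, i, hp, h1, h2⟩ := A.count_le_of_suboptimal X hK hKN hβ hβα hσ hΔ ht1 hgood
      (by linarith [hgap _ hne])
    refine ⟨j, i, hp, h1, h2.trans ?_⟩
    gcongr
    omega
  -- A round with a deviation is paid for by `dev t ≥ 1`; without one, it either has no regret or
  -- belongs to `S`.
  have hround : ∀ t ∈ Finset.Ico (N * K) T, reg t ≤ D * ((if t ∈ S then 1 else 0) + dev t) := by
    intro t ht
    have hterm : ∀ j i, (0 : ℝ) ≤ if A.Deviates α σ X β μ t j i then 1 else 0 := fun j i => by
      split_ifs <;> norm_num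
    have hdev0 : 0 ≤ dev t :=
      Finset.sum_nonneg fun j _ => Finset.sum_nonneg fun i _ => hterm j i
    by_cases hbad : ∃ j i, A.Deviates α σ X β μ t j i
    · obtain ⟨j, i, hji⟩ := hbad
      have h1 : 1 ≤ dev t := by
        calc (1 : ℝ) = if A.Deviates α σ X β μ t j i then 1 else 0 := (if_pos hji).symm
          _ ≤ ∑ i, if A.Deviates α σ X β μ t j i then (1 : ℝ) else 0 :=
            Finset.single_le_sum (fun i _ => hterm j i) (Finset.mem_univ i)
          _ ≤ dev t := Finset.single_le_sum
            (f := fun j => ∑ i, if A.Deviates α σ X β μ t j i then (1 : ℝ) else 0)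
            (fun j _ => Finset.sum_nonneg fun i _ => hterm j i) (Finset.mem_univ j)
      refine (hreg t).trans (le_mul_of_one_le_right hD ?_)
      split_ifs <;> linarith
    · push Not at hbad
      by_cases hopt : minReward μ (A.allocAt α σ X (t + 1)) = maxMin μ
      · have h0 : reg t = 0 := by simp only [reg, hopt, sub_self]
        rw [h0]
        refine mul_nonneg hD (add_nonneg ?_ hdev0)
        split_ifs <;> norm_num
      · rw [if_pos (Finset.mem_filter.2 ⟨ht, hbad, hopt⟩)]
        exact (hreg t).trans (le_mul_of_one_le_right hD (by linarith))
  have hinit : ∑ t ∈ (Finset.range T).filter (· < N * K), reg t ≤ D * (N * K) := by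
    refine (Finset.sum_le_card_nsmul _ _ D fun t _ => hreg t).trans ?_
    rw [nsmul_eq_mul, mul_comm]
    refine mul_le_mul_of_nonneg_left ?_ hD
    have hcard : ((Finset.range T).filter (· < N * K)).card ≤ N * K := by
      refine (Finset.card_le_card (t := Finset.range (N * K)) fun t ht => ?_).trans_eq
        (Finset.card_range _)
      exact Finset.mem_range.2 (Finset.mem_filter.1 ht).2
    exact_mod_cast hcard
  have hrest : (Finset.range T).filter (fun t => ¬ t < N * K) = Finset.Ico (N * K) T := by
    ext t
    simp only [Finset.mem_filter, Finset.mem_range, Finset.mem_Ico]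
    omega
  rw [hsum, ← Finset.sum_filter_add_sum_filter_not (Finset.range T) (· < N * K), hrest]
  have hlate : ∑ t ∈ Finset.Ico (N * K) T, reg t ≤
      D * (S.card + ∑ t ∈ Finset.Ico (N * K) T, dev t) := by
    refine (Finset.sum_le_sum hround).trans_eq ?_
    rw [← Finset.mul_sum, Finset.sum_add_distrib, Finset.sum_boole,
      Finset.filter_mem_eq_inter, Finset.inter_eq_right.2 (Finset.filter_subset _ _)]
  have hS' := mul_le_mul_of_nonneg_left hS hD
  simp only [mul_add] at hlate ⊢
  linarith

/-! ### Expected regret -/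

section Expectation

variable {Ω : Type*} [MeasurableSpace Ω] {P : Measure Ω} [IsProbabilityMeasure P]
  {ε : ℕ → Fin K → Fin N → Ω → ℝ} {μ : Fin K → Fin N → ℝ}

lemma integrable_cumRegret (hK : 1 ≤ K) (hKN : K ≤ N) (hε : ∀ t j i, Measurable (ε t j i))
    {D : ℝ} (hmax : ∀ j₁ j₂ i₁ i₂, |μ j₁ i₁ - μ j₂ i₂| ≤ D) (T : ℕ) :
    Integrable (fun ω => A.cumRegret α σ μ (fun t j i => μ j i + ε t j i ω) T) P := by
  refine Integrable.of_bound (C := T * D)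
    (A.measurable_cumRegret α σ _ μ (fun t j i => (hε t j i).const_add _) T).aestronglyMeasurable
    (ae_of_all _ fun ω => ?_)
  rw [cumRegret, Real.norm_eq_abs, abs_of_nonneg
    (Finset.sum_nonneg fun t _ => sub_nonneg.2 (minReward_le_maxMin μ _))]
  refine (Finset.sum_le_card_nsmul _ _ D fun t _ =>
    maxMin_sub_minReward_le hK hKN hmax _).trans_eq ?_
  rw [Nat.card_Icc, Nat.add_sub_cancel, nsmul_eq_mul]

lemma integral_cumRegret_le (hK : 1 ≤ K) (hKN : K ≤ N) {β : ℝ} (hβ : 2 < β) (hβα : β ≤ α)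
    (hσ : 0 < σ) (hε : ∀ t j i, Measurable (ε t j i))
    (hindep : iIndepFun (fun (t : ℕ) (ω : Ω) (j : Fin K) (i : Fin N) => ε t j i ω) P)
    (hsub : ∀ t j i, HasSubgaussianMGF (ε t j i) (Real.toNNReal (σ ^ 2)) P)
    {Δ D : ℝ} (hΔ : 0 < Δ)
    (hgap : ∀ φ : Alloc K N, minReward μ φ ≠ maxMin μ → Δ < maxMin μ - minReward μ φ)
    (hmax : ∀ j₁ j₂ i₁ i₂, |μ j₁ i₁ - μ j₂ i₂| ≤ D) (T : ℕ) :
    ∫ ω, A.cumRegret α σ μ (fun t j i => μ j i + ε t j i ω) T ∂P ≤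
      D * N * K * ((Real.sqrt (2 * α) + Real.sqrt (2 * β)) ^ 2 * σ ^ 2 / Δ ^ 2 * Real.log T +
        2 / (β - 2) + 1) := by
  classical
  have hD : 0 ≤ D := by
    simpa using hmax ⟨0, hK⟩ ⟨0, hK⟩ ⟨0, hK.trans hKN⟩ ⟨0, hK.trans hKN⟩
  have hβ0 : 0 < β := by linarith
  set C := (Real.sqrt (2 * α) + Real.sqrt (2 * β)) ^ 2 * σ ^ 2 / Δ ^ 2
  let E : ℕ → Fin K → Fin N → Set Ω := fun t j i =>
    {ω | A.Deviates α σ (fun t j i => μ j i + ε t j i ω) β μ t j i}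
  have hE : ∀ t j i, MeasurableSet (E t j i) := fun t j i =>
    A.measurableSet_deviates α σ _ β μ t (fun s _ j i => (hε s j i).const_add _) j i
  have hite : ∀ t j i, (fun ω => if A.Deviates α σ (fun t j i => μ j i + ε t j i ω) β μ t j i
      then (1 : ℝ) else 0) = (E t j i).indicator 1 := fun t j i => by
    ext ω
    simp [E, Set.indicator_apply]
  have hint : ∀ t j i, Integrable (fun ω =>
      if A.Deviates α σ (fun t j i => μ j i + ε t j i ω) β μ t j i then (1 : ℝ) else 0) P :=
    fun t j i => by
      rw [hite]
      exact (integrable_const (1 : ℝ)).indicator (hE t j i)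
  have hint2 : ∀ t j, Integrable (fun ω => ∑ i,
      if A.Deviates α σ (fun t j i => μ j i + ε t j i ω) β μ t j i then (1 : ℝ) else 0) P :=
    fun t j => integrable_finsetSum _ fun i _ => hint t j i
  have hint1 : ∀ t, Integrable (fun ω => ∑ j, ∑ i,
      if A.Deviates α σ (fun t j i => μ j i + ε t j i ω) β μ t j i then (1 : ℝ) else 0) P :=
    fun t => integrable_finsetSum _ fun j _ => hint2 t j
  have hint0 : Integrable (fun ω => ∑ t ∈ Finset.Ico (N * K) T, ∑ j, ∑ i,
      if A.Deviates α σ (fun t j i => μ j i + ε t j i ω) β μ t j i then (1 : ℝ) else 0) P :=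
    integrable_finsetSum _ fun t _ => hint1 t
  have hdev : ∫ ω, ∑ t ∈ Finset.Ico (N * K) T, ∑ j, ∑ i,
      (if A.Deviates α σ (fun t j i => μ j i + ε t j i ω) β μ t j i then (1 : ℝ) else 0) ∂P ≤
        N * K * (2 / (β - 2)) := by
    rw [integral_finsetSum _ fun t _ => hint1 t]
    have hround : ∀ t, ∫ ω, ∑ j, ∑ i,
        (if A.Deviates α σ (fun t j i => μ j i + ε t j i ω) β μ t j i then (1 : ℝ) else 0) ∂P ≤
          N * K * 2 * ((t + 1 : ℕ) : ℝ) ^ (1 - β) := by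
      intro t
      rw [integral_finsetSum _ fun j _ => hint2 t j]
      calc ∑ j, ∫ ω, ∑ i,
            (if A.Deviates α σ (fun t j i => μ j i + ε t j i ω) β μ t j i then (1 : ℝ) else 0) ∂P
          = ∑ j, ∑ i, P.real (E t j i) := by
            refine Finset.sum_congr rfl fun j _ => ?_
            rw [integral_finsetSum _ fun i _ => hint t j i]
            refine Finset.sum_congr rfl fun i _ => ?_
            rw [hite, integral_indicator_one (hE t j i)]
        _ ≤ ∑ _j : Fin K, ∑ _i : Fin N, 2 * ((t + 1 : ℕ) : ℝ) ^ (1 - β) :=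
            Finset.sum_le_sum fun j _ => Finset.sum_le_sum fun i _ =>
              A.measure_deviates_le α σ μ hσ hε hindep hsub hβ0 t j i
        _ = N * K * 2 * ((t + 1 : ℕ) : ℝ) ^ (1 - β) := by
            simp only [Finset.sum_const, Finset.card_univ, Fintype.card_fin, nsmul_eq_mul]
            ring
    refine (Finset.sum_le_sum fun t _ => hround t).trans ?_
    rw [← Finset.mul_sum]
    have h := mul_le_mul_of_nonneg_left
      (sum_Ico_rpow_le hβ (Nat.mul_pos (by omega) hK : 1 ≤ N * K) T)
      (by positivity : (0 : ℝ) ≤ N * K * 2)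
    refine h.trans_eq ?_
    ring
  calc ∫ ω, A.cumRegret α σ μ (fun t j i => μ j i + ε t j i ω) T ∂P
      ≤ ∫ ω, D * (N * K + N * K * (C * Real.log T) +
          ∑ t ∈ Finset.Ico (N * K) T, ∑ j, ∑ i,
            if A.Deviates α σ (fun t j i => μ j i + ε t j i ω) β μ t j i then 1 else 0) ∂P :=
        integral_mono (A.integrable_cumRegret hK hKN hε hmax T)
          (((integrable_const _).add hint0).const_mul D)
          fun ω => A.cumRegret_le hK hKN hβ0 hβα hσ hΔ hgap hmax _ T
    _ = D * (N * K + N * K * (C * Real.log T) + ∫ ω, ∑ t ∈ Finset.Ico (N * K) T, ∑ j, ∑ i,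
          (if A.Deviates α σ (fun t j i => μ j i + ε t j i ω) β μ t j i then (1 : ℝ) else 0)
            ∂P) := by
        rw [integral_const_mul, integral_add (integrable_const _) hint0, integral_const,
          probReal_univ, one_smul]
    _ ≤ D * (N * K + N * K * (C * Real.log T) + N * K * (2 / (β - 2))) := by gcongr
    _ = D * N * K * (C * Real.log T + 2 / (β - 2) + 1) := by ring

end Expectation

end DuelingULCB

/-! ### Choice of `β` and the final constants -/

lemma sqrt_add_sqrt_sq_le {α β : ℝ} (hβ : β ≤ 4) :
    (Real.sqrt (2 * α) + Real.sqrt (2 * β)) ^ 2 ≤ 3 * (Real.sqrt (2 * α) + 2) ^ 2 := by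
  have h0 := Real.sqrt_nonneg (2 * α)
  have h1 : Real.sqrt (2 * β) ≤ 3 := by
    rw [Real.sqrt_le_left (by norm_num)]; linarith
  have h2 := pow_le_pow_left₀ (add_nonneg h0 (Real.sqrt_nonneg (2 * β)))
    (add_le_add_right h1 (Real.sqrt (2 * α))) 2
  nlinarith [sq_nonneg (Real.sqrt (2 * α))]

end FairAlloc

theorem theorem1 {K N : ℕ} (hK : 1 ≤ K) (hKN : K ≤ N)
    {Ω : Type*} [MeasurableSpace Ω] (P : Measure Ω) [IsProbabilityMeasure P]
    -- the confidence parameter, the noise level, and the true rewards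
    (α σ : ℝ) (hα : 2 < α) (hσ : 0 < σ) (μ : Fin K → Fin N → ℝ)
    -- the noise `ε t j i` in round `t` for agent `j` and good `i`: `σ ^ 2`-sub-Gaussian,
    -- independent across rounds
    (ε : ℕ → Fin K → Fin N → Ω → ℝ) (hε : ∀ t j i, Measurable (ε t j i))
    (hindep : iIndepFun (fun (t : ℕ) (ω : Ω) (j : Fin K) (i : Fin N) => ε t j i ω) P)
    (hsub : ∀ t j i, HasSubgaussianMGF (ε t j i) (Real.toNNReal (σ ^ 2)) P)
    -- the gap assumption
    (Δmin Δmax : ℝ) (hΔmin : 0 < Δmin)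
    (hgap : ∀ φ : FairAlloc.Alloc K N,
      FairAlloc.minReward μ φ ≠ FairAlloc.maxMin μ →
        Δmin < FairAlloc.maxMin μ - FairAlloc.minReward μ φ)
    (hmax : ∀ j₁ j₂ i₁ i₂, |μ j₁ i₁ - μ j₂ i₂| ≤ Δmax)
    -- the algorithm and the horizon
    (A : FairAlloc.DuelingULCB K N) (T : ℕ) :
    Integrable (fun ω => A.cumRegret α σ μ (fun t j i => μ j i + ε t j i ω) T) P ∧
    ∫ ω, A.cumRegret α σ μ (fun t j i => μ j i + ε t j i ω) T ∂P ≤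
      3 * Δmax * N * K *
        ((Real.sqrt (2 * α) + 2) ^ 2 * σ ^ 2 / Δmin ^ 2 * Real.log T
          + 2 * ((α - 1) / (α - 2)) + 2) ∧
    (2 ≤ T →
      ∫ ω, A.cumRegret α σ μ (fun t j i => μ j i + ε t j i ω) T ∂P ≤
        3 * Δmax *
          ((Real.sqrt (2 * α) + 2) ^ 2 * σ ^ 2 / Δmin ^ 2
            + (2 * ((α - 1) / (α - 2)) + 2) / Real.log 2) *
          (N * K * Real.log T)) := by

  have hD : 0 ≤ Δmax := by
    simpa using hmax ⟨0, hK⟩ ⟨0, hK⟩ ⟨0, hK.trans hKN⟩ ⟨0, hK.trans hKN⟩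
  have hv : 0 < 1 / (α - 2) := one_div_pos.2 (by linarith)
  have hv' : (α - 1) / (α - 2) = 1 + 1 / (α - 2) := by
    have h : α - 2 ≠ 0 := by linarith
    field_simp
    ring
  have hbound : ∫ ω, A.cumRegret α σ μ (fun t j i => μ j i + ε t j i ω) T ∂P ≤
      3 * Δmax * N * K *
        ((Real.sqrt (2 * α) + 2) ^ 2 * σ ^ 2 / Δmin ^ 2 * Real.log T
          + 2 * ((α - 1) / (α - 2)) + 2) := by
    -- The bound `β ≤ 4` gives `√(2β) ≤ 3`, hence the factor 3 in the leading term; `β ≤ α` and `2 <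
    -- β` are what `integral_cumRegret_le` requires.
    have hβ : 2 < min α 4 := lt_min hα (by norm_num)
    refine (A.integral_cumRegret_le hK hKN hβ (min_le_left α 4) hσ hε hindep hsub hΔmin hgap
      hmax T).trans ?_
    have hL : (Real.sqrt (2 * α) + Real.sqrt (2 * min α 4)) ^ 2 * σ ^ 2 / Δmin ^ 2 *
        Real.log T ≤
          3 * (Real.sqrt (2 * α) + 2) ^ 2 * σ ^ 2 / Δmin ^ 2 * Real.log T := by
      have hlog : 0 ≤ Real.log (T : ℝ) := Real.log_natCast_nonneg T
      gcongr
      exact FairAlloc.sqrt_add_sqrt_sq_le (min_le_right α 4)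
    -- For `α ≤ 4` the left side is `2 / (α - 2)`; otherwise it is `2 / (4 - 2) = 1`.
    have hb : 2 / (min α 4 - 2) ≤ 2 * (1 / (α - 2)) + 1 := by
      rcases min_cases α 4 with ⟨h, -⟩ | ⟨h, -⟩ <;> rw [h]
      · rw [mul_one_div]; linarith
      · linarith
    calc Δmax * N * K * ((Real.sqrt (2 * α) + Real.sqrt (2 * min α 4)) ^ 2 * σ ^ 2 /
          Δmin ^ 2 * Real.log T + 2 / (min α 4 - 2) + 1)
        ≤ Δmax * N * K * (3 * ((Real.sqrt (2 * α) + 2) ^ 2 * σ ^ 2 / Δmin ^ 2 * Real.log T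
          + 2 * ((α - 1) / (α - 2)) + 2)) := by
          refine mul_le_mul_of_nonneg_left ?_ (by positivity)
          rw [hv']
          have h : 3 * (Real.sqrt (2 * α) + 2) ^ 2 * σ ^ 2 / Δmin ^ 2 * Real.log T =
              3 * ((Real.sqrt (2 * α) + 2) ^ 2 * σ ^ 2 / Δmin ^ 2 * Real.log T) := by ring
          linarith
      _ = _ := by ring
  refine ⟨A.integrable_cumRegret hK hKN hε hmax T, hbound, fun hT => hbound.trans ?_⟩
  have hlog2 : 0 < Real.log 2 := Real.log_pos (by norm_num)
  have hlog : Real.log 2 ≤ Real.log T := Real.log_le_log (by norm_num) (by exact_mod_cast hT)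
  -- For `T ≥ 2` the constant term is absorbed using `log T / log 2 ≥ 1`.
  have hc : 2 * ((α - 1) / (α - 2)) + 2 ≤
      (2 * ((α - 1) / (α - 2)) + 2) / Real.log 2 * Real.log T := by
    rw [div_mul_eq_mul_div, le_div_iff₀ hlog2]
    refine mul_le_mul_of_nonneg_left hlog ?_
    rw [hv']
    linarith
  calc 3 * Δmax * N * K * ((Real.sqrt (2 * α) + 2) ^ 2 * σ ^ 2 / Δmin ^ 2 * Real.log T
          + 2 * ((α - 1) / (α - 2)) + 2)
      ≤ 3 * Δmax * N * K * ((Real.sqrt (2 * α) + 2) ^ 2 * σ ^ 2 / Δmin ^ 2 * Real.log T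
          + (2 * ((α - 1) / (α - 2)) + 2) / Real.log 2 * Real.log T) := by
        refine mul_le_mul_of_nonneg_left ?_ (by positivity)
        linarith
    _ = _ := by ring
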